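/- Let $\mathfrak c=2^{\aleph_0}$, let $D$ be a discrete space of cardinality $\mathfrak c$, and let $\beta D$ be its Stone–Čech compactification. Put $$D_\omega=\bigcup\{\overline{M}^{\,\beta D} : M\subset D,\ |M|\le\aleph_0\}\subset\beta D .$$ For a topological space $X$ let $w(X)$ and $nw(X)$ be the weight and the network weight: the least cardinality of a base, respectively of a network (a family of subsets such that every open set is a union of a subfamily), plus $\aleph_0$. Let $nw_{cz}(X)$ be the least cardinality, plus $\aleph_0$, of a $cz$-network of $X$: a family $\mathcal N$ of subsets of $X$ such that every cozero set of $X$ is the union of an at most countable subfamily of $\mathcal N$. A subset $B$ of a compact convex subset $K$ of a Hausdorff locally convex space is called a boundary of $K$ if every continuous affine function $f:K\to\mathbb R$ attains its maximum over $K$ at a point of $B$. Let $K=P(\beta D)$ be the set of Radon probability measures on $\beta D$ with the weak topology, viewed through $\mu\mapsto(f\mapsto\int f\,d\mu)$ as a subset of the dual $C(\beta D)^*$ with the weak-$*$ topology. Then the following hold. 1. $D\subset D_\omega\subset\beta D$; the space $D_\omega$ is dense in $\beta D$, locally compact and countably compact; $\beta D_\omega=\beta D$, in the sense that the canonical extension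 $\beta D_\omega\to\beta D$ of the inclusion $D_\omega\subset\beta D$ is a homeomorphism; $D_\omega$ is the union of $\mathfrak c$ many compact subsets of weight $\mathfrak c$; and $w(D_\omega)=\mathfrak c$. 2. The above identification of $P(\beta D)$ with $K$ is a topological embedding into $C(\beta D)^*$; $K$ is convex and compact; $\beta D$ embeds topologically in $C(\beta D)^*$ through Dirac measures, and its image is exactly the set of extreme points of $K$; and $w(K)=w(\beta D)=2^{\mathfrak c}$. 3. Identified with a set of Dirac measures, $D_\omega$ is a boundary of $K$, and $w(D_\omega)=\mathfrak c<2^{\mathfrak c}=w(K)$. Consequently it is not true that $w(B)=w(K)$ for every compact convex subset $K$ of a Hausdorff locally convex real space and every boundary $B$ of $K$ (a negative answer to a question of Kalenda and Spurný). 4. $nw_{cz}(D_\omega)=2^{\mathfrak c}>\mathfrak c=nw(D_\omega)=w(D_\omega)$. -/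

import Mathlib

universe u

open scoped Cardinal Topology

noncomputable section

/-- The weight `w(X)`: the least cardinality of a base of `X`, plus `ℵ₀`. -/
def weight (X : Type*) [TopologicalSpace X] : Cardinal :=
  sInf {κ | ∃ ℬ : Set (Set X), TopologicalSpace.IsTopologicalBasis ℬ ∧ #ℬ = κ} + ℵ₀

/-- A network of `X`: a family of subsets such that every open set is a union of a subfamily. -/
def IsNetwork {X : Type*} [TopologicalSpace X] (𝒩 : Set (Set X)) : Prop :=
  ∀ U : Set X, IsOpen U → ∃ ℳ ⊆ 𝒩, U = ⋃₀ ℳ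

/-- The network weight `nw(X)`: the least cardinality of a network of `X`, plus `ℵ₀`. -/
def networkWeight (X : Type*) [TopologicalSpace X] : Cardinal :=
  sInf {κ | ∃ 𝒩 : Set (Set X), IsNetwork 𝒩 ∧ #𝒩 = κ} + ℵ₀

/-- A cozero set: the complement of the zero set of a continuous real-valued function. -/
def IsCozeroSet {X : Type*} [TopologicalSpace X] (U : Set X) : Prop :=
  ∃ f : C(X, ℝ), U = {x | f x = 0}ᶜ

/-- A `cz`-network of `X`: a family of subsets such that every cozero set is the union of an
at most countable subfamily. -/
def IsCzNetwork {X : Type*} [TopologicalSpace X] (𝒩 : Set (Set X)) : Prop :=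
  ∀ U : Set X, IsCozeroSet U → ∃ ℳ ⊆ 𝒩, ℳ.Countable ∧ ⋃₀ ℳ = U

/-- The cardinal `nw_cz(X)`: the least cardinality of a `cz`-network of `X`, plus `ℵ₀`. -/
def czNetworkWeight (X : Type*) [TopologicalSpace X] : Cardinal :=
  sInf {κ | ∃ 𝒩 : Set (Set X), IsCzNetwork 𝒩 ∧ #𝒩 = κ} + ℵ₀

/-- `B` is a boundary of the convex compact set `K`: `B ⊆ K` and every continuous affine real
function on `K` attains its maximum over `K` at a point of `B`. Functions on `K` are written as
functions on the ambient space of which only the restriction to `K` matters. -/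
def IsConvexBoundary {E : Type*} [AddCommGroup E] [Module ℝ E] [TopologicalSpace E]
    (K B : Set E) : Prop :=
  B ⊆ K ∧ ∀ f : E → ℝ, ContinuousOn f K →
    (∀ x ∈ K, ∀ y ∈ K, ∀ a b : ℝ, 0 ≤ a → 0 ≤ b → a + b = 1 →
      f (a • x + b • y) = a * f x + b * f y) →
    ∃ b ∈ B, ∀ x ∈ K, f x ≤ f b

/-- The Radon probability measures on `X`, as a subset of the space of all Borel probability
measures on `X` with the weak topology. -/
def radonProb (X : Type*) [TopologicalSpace X] [MeasurableSpace X] [BorelSpace X] :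
    Set (MeasureTheory.ProbabilityMeasure X) :=
  {μ | (μ : MeasureTheory.Measure X).InnerRegular}

/-- For compact `X`, the functional `f ↦ ∫ f dμ` on `C(X, ℝ)` given by a Borel probability
measure `μ`. -/
def integralFunctional {X : Type*} [TopologicalSpace X] [CompactSpace X] [MeasurableSpace X]
    [BorelSpace X] (μ : MeasureTheory.ProbabilityMeasure X) : WeakDual ℝ C(X, ℝ) :=
  StrongDual.toWeakDual (LinearMap.mkContinuous
    { toFun := fun f : C(X, ℝ) => ∫ x, f x ∂(μ : MeasureTheory.Measure X)
      map_add' := fun f g => by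
        simp only [ContinuousMap.add_apply]
        exact MeasureTheory.integral_add
          (f.continuous.integrable_of_hasCompactSupport (HasCompactSupport.of_compactSpace _))
          (g.continuous.integrable_of_hasCompactSupport (HasCompactSupport.of_compactSpace _))
      map_smul' := fun c f => by
        simp only [ContinuousMap.smul_apply, RingHom.id_apply]
        exact MeasureTheory.integral_smul c _ } 1
    (fun f => by
      have h := MeasureTheory.norm_integral_le_of_norm_le_const
        (μ := (μ : MeasureTheory.Measure X)) (f := fun x => f x) (C := ‖f‖)
        (Filter.Eventually.of_forall fun x => f.norm_coe_le_norm x)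
      simpa using h))

theorem integralFunctional_apply {X : Type*} [TopologicalSpace X] [CompactSpace X]
    [MeasurableSpace X] [BorelSpace X] (μ : MeasureTheory.ProbabilityMeasure X) (f : C(X, ℝ)) :
    integralFunctional μ f = ∫ x, f x ∂(μ : MeasureTheory.Measure X) := rfl

/-- For compact `X`, the set `P(X)` of Radon probability measures, realised in the locally convex
space `C(X, ℝ)*` with the weak-* topology by identifying a measure with its integral. -/
def radonProbConvex (X : Type*) [TopologicalSpace X] [CompactSpace X] [MeasurableSpace X]
    [BorelSpace X] : Set (WeakDual ℝ C(X, ℝ)) :=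
  integralFunctional '' radonProb X

/-- The Dirac measure at `x`, as a functional on `C(X, ℝ)`. -/
def diracFunctional {X : Type*} [TopologicalSpace X] [CompactSpace X] [MeasurableSpace X]
    [BorelSpace X] (x : X) : WeakDual ℝ C(X, ℝ) :=
  integralFunctional ⟨MeasureTheory.Measure.dirac x, inferInstance⟩

/-- The subset `D_ω` of `βD`: the union of the closures in `βD` of the at most countable
subsets of `D`. -/
def countableClosureUnion (D : Type*) [TopologicalSpace D] : Set (StoneCech D) :=
  ⋃ M ∈ {M : Set D | M.Countable}, closure (stoneCechUnit '' M)

end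

/-! For discrete `D` the closures in `βD` of subsets of `D` are clopen, distinct subsets have
distinct closures, and these closures form a base. Hence `w(βD) = 2^𝔠`. On `D_ω` the closures of
countable sets suffice for a base, and there are only `𝔠^ℵ₀ = 𝔠` of these. The `𝔠` isolated points
bound the network weight from below.

Although small in weight, `D_ω` is large in `βD`: any sequence in it lies in the closure of a single
countable subset of `D`, which is compact and contained in `D_ω`. This gives countable compactness,
attainment on `D_ω` of the maximum of any continuous function on `βD`, and the fact that every
nonempty `G_δ` of `βD` meets `D_ω`.

Boundary: by Bauer's principle a continuous affine function on `K` is maximal at an extreme point,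
that is, at a Dirac measure, and its restriction to `βD` attains its maximum on `D_ω`.

For `nw_cz`, the `G_δ` property shows that the closures in `βD` of the members of a `cz`-network of
`D_ω` contain, for each point of a clopen set, one that holds the point and stays inside the set.
Pairs of members then index enough clopen sets to separate the points of `βD`, so the network has at
least `w(βD)` members. -/

/-! ### Generalities on weight -/

theorem weight_le_of_isTopologicalBasis {X : Type*} [TopologicalSpace X] {ℬ : Set (Set X)}
    (h : TopologicalSpace.IsTopologicalBasis ℬ) : weight X ≤ #ℬ + ℵ₀ :=
  add_le_add_left (csInf_le' (s := {κ | ∃ ℬ : Set (Set X),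
    TopologicalSpace.IsTopologicalBasis ℬ ∧ #ℬ = κ}) ⟨ℬ, h, rfl⟩) _

theorem exists_isTopologicalBasis_weight_eq (X : Type*) [TopologicalSpace X] :
    ∃ ℬ : Set (Set X), TopologicalSpace.IsTopologicalBasis ℬ ∧ weight X = #ℬ + ℵ₀ := by
  obtain ⟨ℬ, h, h'⟩ := csInf_mem (s := {κ | ∃ ℬ : Set (Set X),
    TopologicalSpace.IsTopologicalBasis ℬ ∧ #ℬ = κ})
    ⟨_, _, TopologicalSpace.isTopologicalBasis_opens, rfl⟩
  exact ⟨ℬ, h, by rw [weight, h']⟩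

theorem weight_le_of_eq_generateFrom {X : Type*} [t : TopologicalSpace X] {s : Set (Set X)}
    (h : t = TopologicalSpace.generateFrom s) : weight X ≤ #s + ℵ₀ := by
  have hfin : #{f : Set (Set X) | f.Finite ∧ f ⊆ s} ≤ #s + ℵ₀ := by
    have hsurj : Function.Surjective (fun F : Finset s =>
        (⟨Subtype.val '' (F : Set s), F.finite_toSet.image _, by simp⟩ :
          {f : Set (Set X) | f.Finite ∧ f ⊆ s})) := by
      rintro ⟨f, hf, hfs⟩
      refine ⟨(hf.preimage Subtype.val_injective.injOn).toFinset, Subtype.ext ?_⟩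
      simpa using hfs
    refine (Cardinal.mk_le_of_surjective hsurj).trans ?_
    rcases finite_or_infinite s with hs | hs
    · exact (Cardinal.lt_aleph0_of_finite _).le.trans (self_le_add_left _ _)
    · rw [Cardinal.mk_finset_of_infinite]
      exact self_le_add_right _ _
  refine (weight_le_of_isTopologicalBasis
    (TopologicalSpace.isTopologicalBasis_of_subbasis h)).trans ?_
  refine (add_le_add_left (Cardinal.mk_image_le.trans hfin) _).trans ?_
  rw [add_assoc, Cardinal.aleph0_add_aleph0]

theorem Topology.IsEmbedding.weight_le {X Y : Type u} [TopologicalSpace X] [TopologicalSpace Y]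
    {f : X → Y} (hf : IsEmbedding f) : weight X ≤ weight Y := by
  obtain ⟨ℬ, hℬ, h⟩ := exists_isTopologicalBasis_weight_eq Y
  rw [h]
  exact (weight_le_of_isTopologicalBasis (hℬ.isInducing hf.isInducing)).trans
    (add_le_add_left Cardinal.mk_image_le _)

theorem Homeomorph.weight_eq {X Y : Type u} [TopologicalSpace X] [TopologicalSpace Y]
    (e : X ≃ₜ Y) : weight X = weight Y :=
  le_antisymm e.isEmbedding.weight_le e.symm.isEmbedding.weight_le

/-- In a compact space, the number of clopen sets is at most the weight. -/
theorem mk_isClopen_le_weight (X : Type*) [TopologicalSpace X] [CompactSpace X] :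
    #{U : Set X | IsClopen U} ≤ weight X := by
  obtain ⟨ℬ, hℬ, h⟩ := exists_isTopologicalBasis_weight_eq X
  -- A clopen set is compact and open, hence a finite union of members of the base.
  have hsub : {U : Set X | IsClopen U} ⊆ Set.range (fun F : Finset ℬ => ⋃ V ∈ F, (V : Set X)) := by
    rintro U hU
    obtain ⟨F, hF, hUF⟩ := hU.1.isCompact.elim_finite_subcover_image (b := {V | V ∈ ℬ ∧ V ⊆ U})
      (c := id) (fun V hV => hℬ.isOpen hV.1) (fun x hx => by
        obtain ⟨V, hV, hxV, hVU⟩ := hℬ.exists_subset_of_mem_open hx hU.2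
        exact Set.mem_biUnion (show V ∈ {V | V ∈ ℬ ∧ V ⊆ U} from ⟨hV, hVU⟩) hxV)
    refine ⟨(hUF.1.preimage Subtype.val_injective.injOn).toFinset, ?_⟩
    ext x
    simp only [Set.Finite.mem_toFinset, Set.mem_preimage, Set.mem_iUnion, Subtype.exists]
    constructor
    · rintro ⟨V, hV, hVF, hx⟩
      exact (hF hVF).2 hx
    · intro hx
      obtain ⟨V, hV, hxV⟩ := Set.mem_iUnion₂.1 (hUF.2 hx)
      exact ⟨V, (hF hV).1, hV, hxV⟩
  refine (Cardinal.mk_le_mk_of_subset hsub).trans (Cardinal.mk_range_le.trans ?_)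
  rw [h]
  rcases finite_or_infinite ℬ with hs | hs
  · exact (Cardinal.lt_aleph0_of_finite _).le.trans (self_le_add_left _ _)
  · rw [Cardinal.mk_finset_of_infinite]
    exact self_le_add_right _ _

/-! ### Clopen closures and the weight of `βD` -/

section StoneCech

variable {D : Type u} [TopologicalSpace D]

theorem closure_stoneCechUnit_preimage {U : Set (StoneCech D)} (hU : IsOpen U) :
    closure (stoneCechUnit '' (stoneCechUnit ⁻¹' U)) = closure U := by
  rw [Set.image_preimage_eq_inter_range]
  exact (closure_mono Set.inter_subset_left).antisymm
    (closure_minimal (denseRange_stoneCechUnit.open_subset_closure_inter hU) isClosed_closure)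

theorem mem_closure_stoneCechUnit_univ (x : StoneCech D) :
    x ∈ closure (stoneCechUnit '' (Set.univ : Set D)) := by
  rw [Set.image_univ]
  exact denseRange_stoneCechUnit x

theorem mem_countableClosureUnion {x : StoneCech D} :
    x ∈ countableClosureUnion D ↔
      ∃ M : Set D, M.Countable ∧ x ∈ closure (stoneCechUnit '' M) := by
  simp [countableClosureUnion]

variable [DiscreteTopology D]

/-- The indicator of `A` is continuous on the discrete space `D`, so it extends to a map from `βD`
to `Bool`. -/
theorem exists_isClopen_stoneCechUnit_mem_iff (A : Set D) :
    ∃ U : Set (StoneCech D), IsClopen U ∧ ∀ d, stoneCechUnit d ∈ U ↔ d ∈ A := by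
  classical
  have hc : Continuous (fun d : D => decide (d ∈ A)) := continuous_of_discreteTopology
  refine ⟨stoneCechExtend hc ⁻¹' {true}, (isClopen_discrete _).preimage
    (continuous_stoneCechExtend hc), fun d => ?_⟩
  simp

theorem isClopen_closure_stoneCechUnit (A : Set D) : IsClopen (closure (stoneCechUnit '' A)) := by
  obtain ⟨U, hU, h⟩ := exists_isClopen_stoneCechUnit_mem_iff A
  have : stoneCechUnit ⁻¹' U = A := Set.ext h
  rw [← this, closure_stoneCechUnit_preimage hU.2, hU.1.closure_eq]
  exact hU

theorem stoneCechUnit_mem_closure_iff {A : Set D} {d : D} :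
    stoneCechUnit d ∈ closure (stoneCechUnit '' A) ↔ d ∈ A := by
  refine ⟨fun hd => ?_, fun hd => subset_closure ⟨d, hd, rfl⟩⟩
  obtain ⟨U, hU, h⟩ := exists_isClopen_stoneCechUnit_mem_iff A
  refine (h d).1 (closure_minimal ?_ hU.1 hd)
  rintro _ ⟨a, ha, rfl⟩
  exact (h a).2 ha

theorem stoneCechUnit_preimage_closure (A : Set D) :
    stoneCechUnit ⁻¹' closure (stoneCechUnit '' A) = A :=
  Set.ext fun _ => stoneCechUnit_mem_closure_iff

theorem closure_stoneCechUnit_injective :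
    Function.Injective fun A : Set D => closure (stoneCechUnit '' A) :=
  Function.LeftInverse.injective (g := fun U => stoneCechUnit ⁻¹' U) stoneCechUnit_preimage_closure

theorem stoneCechUnit_injective : Function.Injective (stoneCechUnit : D → StoneCech D) := by
  intro a b h
  have : stoneCechUnit b ∈ closure (stoneCechUnit '' {a}) :=
    subset_closure ⟨a, rfl, h⟩
  exact (stoneCechUnit_mem_closure_iff.1 this).symm

/-- Regularity gives a closed neighbourhood of `x` inside `U` and the closure of `A`; `B` is the
trace on `D` of its interior. -/
theorem exists_closure_stoneCechUnit_subset {x : StoneCech D} {U : Set (StoneCech D)}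
    (hx : x ∈ U) (hU : IsOpen U) {A : Set D} (hA : x ∈ closure (stoneCechUnit '' A)) :
    ∃ B ⊆ A, x ∈ closure (stoneCechUnit '' B) ∧ closure (stoneCechUnit '' B) ⊆ U := by
  obtain ⟨C, hC, hCc, hCU⟩ := exists_mem_nhds_isClosed_subset
    ((hU.inter (isClopen_closure_stoneCechUnit A).2).mem_nhds ⟨hx, hA⟩)
  refine ⟨stoneCechUnit ⁻¹' interior C, ?_, ?_, ?_⟩
  · intro d hd
    exact stoneCechUnit_mem_closure_iff.1 (hCU (interior_subset hd)).2
  · rw [closure_stoneCechUnit_preimage isOpen_interior]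
    exact subset_closure (mem_interior_iff_mem_nhds.2 hC)
  · rw [closure_stoneCechUnit_preimage isOpen_interior]
    exact (closure_minimal interior_subset hCc).trans (hCU.trans Set.inter_subset_left)

/-- A lower set of subsets of `D` whose closures cover `S` gives a base of `S`. -/
theorem isTopologicalBasis_closure_stoneCechUnit {S : Set (StoneCech D)} {𝒜 : Set (Set D)}
    (hlow : IsLowerSet 𝒜) (hS : ∀ x ∈ S, ∃ A ∈ 𝒜, x ∈ closure (stoneCechUnit '' A)) :
    TopologicalSpace.IsTopologicalBasis
      ((fun A => (Subtype.val ⁻¹' closure (stoneCechUnit '' A) : Set S)) '' 𝒜) := by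
  refine TopologicalSpace.isTopologicalBasis_of_isOpen_of_nhds ?_ ?_
  · rintro _ ⟨A, -, rfl⟩
    exact (isClopen_closure_stoneCechUnit A).2.preimage continuous_subtype_val
  · rintro x _ hx ⟨U, hU, rfl⟩
    obtain ⟨A, hA, hxA⟩ := hS x x.2
    obtain ⟨B, hBA, hxB, hBU⟩ := exists_closure_stoneCechUnit_subset hx hU hxA
    exact ⟨_, ⟨B, hlow hBA hA, rfl⟩, hxB, Set.preimage_mono hBU⟩

theorem weight_le_of_closure_stoneCechUnit_cover {S : Set (StoneCech D)} {𝒜 : Set (Set D)}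
    (hlow : IsLowerSet 𝒜) (hS : ∀ x ∈ S, ∃ A ∈ 𝒜, x ∈ closure (stoneCechUnit '' A)) :
    weight S ≤ #𝒜 + ℵ₀ :=
  (weight_le_of_isTopologicalBasis (isTopologicalBasis_closure_stoneCechUnit hlow hS)).trans
    (add_le_add_left Cardinal.mk_image_le _)

/-- The closures of the `2 ^ #M` subsets of `M` form a base, and they are pairwise distinct clopen
sets of a compact space. -/
theorem weight_closure_stoneCechUnit {M : Set D} (hM : M.Infinite) :
    weight (closure (stoneCechUnit '' M)) = 2 ^ #M := by
  have hM' : ℵ₀ ≤ #M := Cardinal.infinite_iff.1 hM.to_subtype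
  apply le_antisymm
  · refine (weight_le_of_closure_stoneCechUnit_cover (𝒜 := 𝒫 M)
      (fun A B hBA hA => hBA.trans hA) fun x hx => ⟨M, Set.mem_powerset subset_rfl, hx⟩).trans ?_
    rw [Cardinal.mk_powerset, Cardinal.add_eq_left (hM'.trans (Cardinal.cantor _).le)
      (hM'.trans (Cardinal.cantor _).le)]
  · have : CompactSpace (closure (stoneCechUnit '' M)) :=
      isCompact_iff_compactSpace.1 isClosed_closure.isCompact
    rw [← Cardinal.mk_powerset]
    refine le_trans ?_ (mk_isClopen_le_weight _)
    refine Cardinal.mk_le_of_injective (f := fun A : 𝒫 M =>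
      ⟨Subtype.val ⁻¹' closure (stoneCechUnit '' (A : Set D)),
        (isClopen_closure_stoneCechUnit _).preimage continuous_subtype_val⟩) ?_
    rintro ⟨A, hA⟩ ⟨B, hB⟩ h
    have h : (Subtype.val ⁻¹' closure (stoneCechUnit '' A) : Set (closure (stoneCechUnit '' M))) =
      Subtype.val ⁻¹' closure (stoneCechUnit '' B) := congrArg Subtype.val h
    rw [Subtype.preimage_val_eq_preimage_val_iff,
      Set.inter_eq_right.2 (closure_mono (Set.image_mono hA)),
      Set.inter_eq_right.2 (closure_mono (Set.image_mono hB))] at h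
    exact Subtype.ext (closure_stoneCechUnit_injective h)

theorem weight_stoneCech [Infinite D] : weight (StoneCech D) = 2 ^ #D := by
  have h := weight_closure_stoneCechUnit (Set.infinite_univ (α := D))
  rw [Cardinal.mk_univ] at h
  rw [← h]
  have hu : closure (stoneCechUnit '' (Set.univ : Set D)) = Set.univ :=
    Set.eq_univ_of_forall mem_closure_stoneCechUnit_univ
  exact ((Homeomorph.setCongr hu).trans (Homeomorph.Set.univ _)).symm.weight_eq

end StoneCech

/-! ### The space `D_ω`: compactness, weight and network weight -/

theorem mk_countable_le_continuum {D : Type u} (hD : #D = Cardinal.continuum.{u}) :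
    #{M : Set D | M.Countable} ≤ Cardinal.continuum.{u} := by
  have h := Cardinal.mk_bounded_set_le D ℵ₀
  rw [hD, max_eq_left Cardinal.aleph0_le_continuum, Cardinal.continuum_power_aleph0] at h
  simpa only [Cardinal.le_aleph0_iff_set_countable] using! h

theorem networkWeight_le_weight (X : Type*) [TopologicalSpace X] :
    networkWeight X ≤ weight X := by
  obtain ⟨ℬ, hℬ, h⟩ := exists_isTopologicalBasis_weight_eq X
  rw [h]
  refine add_le_add_left (csInf_le' (s := {κ | ∃ 𝒩 : Set (Set X), IsNetwork 𝒩 ∧ #𝒩 = κ})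
    ⟨ℬ, fun U hU => ?_, rfl⟩) _
  obtain ⟨S, hS, hUS⟩ := hℬ.open_eq_sUnion hU
  exact ⟨S, hS, hUS⟩

section CountableClosureUnion

variable {D : Type u} [TopologicalSpace D]

theorem range_stoneCechUnit_subset_countableClosureUnion :
    Set.range (stoneCechUnit : D → StoneCech D) ⊆ countableClosureUnion D := by
  rintro _ ⟨d, rfl⟩
  exact mem_countableClosureUnion.2
    ⟨{d}, Set.countable_singleton d, subset_closure ⟨d, rfl, rfl⟩⟩

theorem dense_countableClosureUnion : Dense (countableClosureUnion D) :=
  denseRange_stoneCechUnit.mono range_stoneCechUnit_subset_countableClosureUnion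

theorem closure_stoneCechUnit_subset_countableClosureUnion {M : Set D} (hM : M.Countable) :
    closure (stoneCechUnit '' M) ⊆ countableClosureUnion D :=
  fun _ hx => mem_countableClosureUnion.2 ⟨M, hM, hx⟩

theorem exists_countable_forall_mem_closure_stoneCechUnit {x : ℕ → StoneCech D}
    (hx : ∀ n, x n ∈ countableClosureUnion D) :
    ∃ M : Set D, M.Countable ∧ ∀ n, x n ∈ closure (stoneCechUnit '' M) := by
  choose M hM hxM using fun n => mem_countableClosureUnion.1 (hx n)
  exact ⟨⋃ n, M n, Set.countable_iUnion hM, fun n =>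
    closure_mono (Set.image_mono (Set.subset_iUnion M n)) (hxM n)⟩

instance countablyCompactSpace_countableClosureUnion :
    CountablyCompactSpace (countableClosureUnion D) := by
  rw [← isCountablyCompact_iff_countablyCompactSpace]
  intro f _ _ hf
  -- Since `f` is countably generated, some sequence tends to it, and cluster points of the sequence
  -- are cluster points of `f`. The sequence is in `D_ω` only eventually, whence the shift by `N`.
  obtain ⟨x, hx⟩ := f.exists_seq_tendsto
  obtain ⟨N, hN⟩ := Filter.eventually_atTop.1 (hx.eventually (hf (Filter.mem_principal_self _)))
  obtain ⟨M, hM, hxM⟩ := exists_countable_forall_mem_closure_stoneCechUnit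
    (x := fun n => x (n + N)) fun n => hN _ (Nat.le_add_left _ _)
  obtain ⟨a, ha, hac⟩ := (isClosed_closure (s := stoneCechUnit '' M)).isCompact
    (f := Filter.map (fun n => x (n + N)) Filter.atTop)
    (Filter.le_principal_iff.2 (Filter.eventually_map.2 (Filter.Eventually.of_forall hxM)))
  exact ⟨a, closure_stoneCechUnit_subset_countableClosureUnion hM ha,
    hac.mono (hx.comp (Filter.tendsto_add_atTop_nat N))⟩

/-- A continuous real function on `βD` attains its maximum on `D_ω`. -/
theorem exists_mem_countableClosureUnion_forall_le [Nonempty D] {g : StoneCech D → ℝ}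
    (hg : Continuous g) : ∃ b ∈ countableClosureUnion D, ∀ x, g x ≤ g b := by
  obtain ⟨z, -, hz⟩ := isCompact_univ.exists_isMaxOn
    (Set.nonempty_of_mem (Set.mem_univ (stoneCechUnit (Classical.arbitrary D)))) hg.continuousOn
  have hd : ∀ n : ℕ, ∃ d : D, g z - 1 / (n + 1 : ℝ) < g (stoneCechUnit d) := by
    intro n
    obtain ⟨_, hy, d, rfl⟩ := denseRange_stoneCechUnit.inter_open_nonempty
      {y | g z - 1 / (n + 1 : ℝ) < g y} (isOpen_lt continuous_const hg)
      ⟨z, (sub_lt_self (g z) Nat.one_div_pos_of_nat : g z - 1 / (n + 1 : ℝ) < g z)⟩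
    exact ⟨d, hy⟩
  choose d hd using hd
  -- The maximum over the closure of the countable set of all `d n` dominates every `g (d n)`, hence
  -- their limit `g z`.
  obtain ⟨b, hb, hbmax⟩ := (isClosed_closure
    (s := stoneCechUnit '' (Set.range d))).isCompact.exists_isMaxOn
    (Set.nonempty_of_mem (subset_closure ⟨d 0, ⟨0, rfl⟩, rfl⟩)) hg.continuousOn
  refine ⟨b, closure_stoneCechUnit_subset_countableClosureUnion (Set.countable_range d) hb,
    fun x => (hz (Set.mem_univ x)).trans ?_⟩
  have hlim : Filter.Tendsto (fun n : ℕ => g z - 1 / (n + 1 : ℝ)) Filter.atTop (𝓝 (g z - 0)) :=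
    tendsto_const_nhds.sub tendsto_one_div_add_atTop_nhds_zero_nat
  rw [sub_zero] at hlim
  exact le_of_tendsto' hlim fun n => (hd n).le.trans (hbmax (subset_closure ⟨d n, ⟨n, rfl⟩, rfl⟩))

variable [DiscreteTopology D]

theorem isOpen_countableClosureUnion : IsOpen (countableClosureUnion D) :=
  isOpen_biUnion fun M _ => (isClopen_closure_stoneCechUnit M).2

/-- The inverse extends the map from `D` into the compactification of `D_ω`; both composites fix the
dense image of `D`. -/
theorem isHomeomorph_stoneCechExtend_countableClosureUnion :
    IsHomeomorph (stoneCechExtend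
      (continuous_subtype_val :
        Continuous (Subtype.val : countableClosureUnion D → StoneCech D))) := by
  set e := stoneCechExtend (continuous_subtype_val :
    Continuous (Subtype.val : countableClosureUnion D → StoneCech D)) with he
  have hec : Continuous e := continuous_stoneCechExtend _
  let i : D → countableClosureUnion D := fun d =>
    ⟨stoneCechUnit d, range_stoneCechUnit_subset_countableClosureUnion ⟨d, rfl⟩⟩
  have hi : DenseRange i := by
    intro x
    rw [Topology.IsInducing.subtypeVal.closure_eq_preimage_closure_image, Set.mem_preimage,
      ← Set.range_comp]
    exact denseRange_stoneCechUnit _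
  have hj : Continuous (stoneCechUnit ∘ i) := continuous_of_discreteTopology
  have hgc := continuous_stoneCechExtend hj
  have hleft : stoneCechExtend hj ∘ e = id := by
    refine (denseRange_stoneCechUnit.comp hi continuous_stoneCechUnit).equalizer
      (hgc.comp hec) continuous_id (funext fun d => ?_)
    simp [he, i]
  have hright : e ∘ stoneCechExtend hj = id := by
    refine denseRange_stoneCechUnit.equalizer (hec.comp hgc) continuous_id (funext fun d => ?_)
    simp [he, i]
  exact (Homeomorph.mk ⟨e, stoneCechExtend hj, congrFun hleft, congrFun hright⟩ hec
    hgc).isHomeomorph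

theorem isOpen_singleton_countableClosureUnion (d : D) :
    IsOpen ({⟨stoneCechUnit d, range_stoneCechUnit_subset_countableClosureUnion ⟨d, rfl⟩⟩} :
      Set (countableClosureUnion D)) := by
  have h : (Subtype.val ⁻¹' closure (stoneCechUnit '' {d}) : Set (countableClosureUnion D)) =
      {⟨stoneCechUnit d, range_stoneCechUnit_subset_countableClosureUnion ⟨d, rfl⟩⟩} := by
    ext x
    simp [Subtype.ext_iff]
  rw [← h]
  exact (isClopen_closure_stoneCechUnit _).2.preimage continuous_subtype_val

/-- Points of `D` are isolated in `D_ω`, and a network must contain every open singleton. -/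
theorem mk_le_of_isNetwork_countableClosureUnion {𝒩 : Set (Set (countableClosureUnion D))}
    (h : IsNetwork 𝒩) : #D ≤ #𝒩 := by
  have hmem : ∀ d : D,
      {⟨stoneCechUnit d, range_stoneCechUnit_subset_countableClosureUnion ⟨d, rfl⟩⟩} ∈ 𝒩 := by
    intro d
    obtain ⟨ℳ, hℳ, hd⟩ := h _ (isOpen_singleton_countableClosureUnion d)
    obtain ⟨N, hN, hdN⟩ := hd.subset (Set.mem_singleton _)
    have : N = _ := (Set.subset_singleton_iff_eq.1
      (hd.symm ▸ Set.subset_sUnion_of_mem hN)).resolve_left (Set.nonempty_of_mem hdN).ne_empty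
    exact this ▸ hℳ hN
  refine Cardinal.mk_le_of_injective (f := fun d => (⟨_, hmem d⟩ : 𝒩)) fun a b hab => ?_
  have := Set.singleton_injective (congrArg Subtype.val hab)
  exact stoneCechUnit_injective (congrArg Subtype.val this)

theorem mk_le_networkWeight_countableClosureUnion :
    #D ≤ networkWeight (countableClosureUnion D) := by
  obtain ⟨𝒩, h, h'⟩ := csInf_mem (s := {κ | ∃ 𝒩 : Set (Set (countableClosureUnion D)),
    IsNetwork 𝒩 ∧ #𝒩 = κ}) ⟨_, {U | IsOpen U}, fun U hU => ⟨{U}, by simpa, by simp⟩, rfl⟩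
  rw [networkWeight, ← h']
  exact (mk_le_of_isNetwork_countableClosureUnion h).trans (self_le_add_right _ _)

theorem weight_countableClosureUnion_le (hD : #D = Cardinal.continuum.{u}) :
    weight (countableClosureUnion D) ≤ Cardinal.continuum.{u} := by
  refine (weight_le_of_closure_stoneCechUnit_cover (𝒜 := {M : Set D | M.Countable})
    (fun A B hBA hA => Set.Countable.mono hBA hA) fun x => mem_countableClosureUnion.1).trans ?_
  exact (add_le_add_left (mk_countable_le_continuum hD) _).trans_eq Cardinal.continuum_add_aleph0

theorem weight_countableClosureUnion (hD : #D = Cardinal.continuum.{u}) :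
    weight (countableClosureUnion D) = Cardinal.continuum.{u} :=
  (weight_countableClosureUnion_le hD).antisymm
    ((hD.symm.trans_le mk_le_networkWeight_countableClosureUnion).trans
      (networkWeight_le_weight _))

theorem networkWeight_countableClosureUnion (hD : #D = Cardinal.continuum.{u}) :
    networkWeight (countableClosureUnion D) = Cardinal.continuum.{u} :=
  ((networkWeight_le_weight _).trans (weight_countableClosureUnion_le hD)).antisymm
    (hD.symm.trans_le mk_le_networkWeight_countableClosureUnion)

theorem exists_compact_cover_countableClosureUnion (hD : #D = Cardinal.continuum.{u}) :
    ∃ 𝒞 : Set (Set (StoneCech D)), #𝒞 = Cardinal.continuum.{u} ∧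
      ⋃₀ 𝒞 = countableClosureUnion D ∧
      ∀ C ∈ 𝒞, IsCompact C ∧ weight C = Cardinal.continuum.{u} := by
  have : Infinite D := Cardinal.infinite_iff.2 (hD ▸ Cardinal.aleph0_le_continuum)
  -- Finite sets are excluded because their closures have weight only `ℵ₀`.
  let 𝒜 : Set (Set D) := {M | M.Countable ∧ M.Infinite}
  have hext : ∀ M : Set D, M.Countable → ∃ A ∈ 𝒜, M ⊆ A := fun M hM =>
    ⟨M ∪ Set.range (Infinite.natEmbedding D), ⟨hM.union (Set.countable_range _),
      (Set.infinite_range_of_injective (Infinite.natEmbedding D).injective).mono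
        Set.subset_union_right⟩, Set.subset_union_left⟩
  refine ⟨(fun M => closure (stoneCechUnit '' M)) '' 𝒜, ?_, ?_, ?_⟩
  · rw [Cardinal.mk_image_eq closure_stoneCechUnit_injective]
    refine le_antisymm ((Cardinal.mk_le_mk_of_subset fun M hM => hM.1).trans
      (mk_countable_le_continuum hD)) (not_lt.1 fun hlt => ?_)
    -- Fewer than `𝔠` countable sets cannot cover the `𝔠` points of `D`.
    have hcov : ⋃₀ 𝒜 = Set.univ := by
      refine Set.eq_univ_of_forall fun d => ?_
      obtain ⟨A, hA, hdA⟩ := hext {d} (Set.countable_singleton d)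
      exact ⟨A, hA, hdA rfl⟩
    have h := Cardinal.mk_sUnion_le 𝒜
    rw [hcov, Cardinal.mk_univ, hD] at h
    refine absurd h (not_le.2 (lt_of_le_of_lt (mul_le_mul_right
      (ciSup_le' fun A : 𝒜 => Cardinal.le_aleph0_iff_set_countable.2 A.2.1) _)
      (Cardinal.mul_lt_of_lt Cardinal.aleph0_le_continuum hlt Cardinal.aleph0_lt_continuum)))
  · ext x
    rw [Set.sUnion_image, Set.mem_iUnion₂, mem_countableClosureUnion]
    constructor
    · rintro ⟨M, hM, hx⟩
      exact ⟨M, hM.1, hx⟩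
    · rintro ⟨M, hM, hx⟩
      obtain ⟨A, hA, hMA⟩ := hext M hM
      exact ⟨A, hA, closure_mono (Set.image_mono hMA) hx⟩
  · rintro _ ⟨M, hM, rfl⟩
    refine ⟨isClosed_closure.isCompact, ?_⟩
    rw [weight_closure_stoneCechUnit hM.2, ← Cardinal.two_power_aleph0]
    congr 1
    exact le_antisymm (Cardinal.le_aleph0_iff_set_countable.2 hM.1)
      (Cardinal.infinite_iff.1 hM.2.to_subtype)

end CountableClosureUnion

/-! ### Weight and continuous real functions -/

/-- The weight of a compact space is at most the cardinality of any infinite family of continuous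
real functions separating its points. -/
theorem weight_le_of_separating {X ι : Type u} [t : TopologicalSpace X] [CompactSpace X]
    (f : ι → X → ℝ) (hf : ∀ i, Continuous (f i)) (hsep : ∀ x y, x ≠ y → ∃ i, f i x ≠ f i y) :
    weight X ≤ #ι + ℵ₀ := by
  let V : ι × ℚ × Bool → Set X := fun p =>
    if p.2.2 then {x | f p.1 x < p.2.1} else {x | (p.2.1 : ℝ) < f p.1 x}
  have hle : t ≤ (.generateFrom (Set.range V)) := by
    refine le_generateFrom ?_
    rintro _ ⟨⟨i, q, b⟩, rfl⟩
    cases b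
    · exact isOpen_lt continuous_const (hf i)
    · exact isOpen_lt (hf i) continuous_const
  have hT2 : @T2Space X (.generateFrom (Set.range V)) := by
    refine @T2Space.mk X (.generateFrom (Set.range V)) fun x y hxy => ?_
    have hlt : ∀ (i : ι) (q : ℚ),
        IsOpen[.generateFrom (Set.range V)] {x | f i x < q} ∧
          IsOpen[.generateFrom (Set.range V)] {x | (q : ℝ) < f i x} :=
      fun i q => ⟨TopologicalSpace.isOpen_generateFrom_of_mem ⟨(i, q, true), rfl⟩,
        TopologicalSpace.isOpen_generateFrom_of_mem ⟨(i, q, false), rfl⟩⟩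
    have hdisj : ∀ (i : ι) (q : ℚ), Disjoint {x | f i x < q} {x | (q : ℝ) < f i x} :=
      fun i q => Set.disjoint_left.2 fun z (hz : f i z < q) (hz' : q < f i z) => lt_asymm hz hz'
    obtain ⟨i, hi⟩ := hsep x y hxy
    rcases lt_or_gt_of_ne hi with h | h
    · obtain ⟨q, hq, hq'⟩ := exists_rat_btwn h
      exact ⟨_, _, (hlt i q).1, (hlt i q).2, hq, hq', hdisj i q⟩
    · obtain ⟨q, hq, hq'⟩ := exists_rat_btwn h
      exact ⟨_, _, (hlt i q).2, (hlt i q).1, hq', hq, (hdisj i q).symm⟩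
  -- A compact topology has no strictly coarser Hausdorff topology.
  have heq : t = (.generateFrom (Set.range V)) := by
    have h := (@isHomeomorph_iff_continuous_bijective X X t (.generateFrom (Set.range V)) id _ hT2).2
      ⟨continuous_id_of_le hle, Function.bijective_id⟩
    refine le_antisymm hle fun U hU => ?_
    have hU' := @IsHomeomorph.isOpenMap X X t (.generateFrom (Set.range V)) id h U hU
    rwa [Set.image_id] at hU'
  refine (weight_le_of_eq_generateFrom heq).trans ?_
  refine (add_le_add_left Cardinal.mk_range_le _).trans ?_
  rw [Cardinal.mk_prod, Cardinal.lift_id'.{0, u}]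
  have hQ : Cardinal.lift.{u} #(ℚ × Bool) ≤ ℵ₀ := by
    rw [Cardinal.lift_le_aleph0]
    exact Cardinal.mk_le_aleph0
  calc #ι * Cardinal.lift.{u} #(ℚ × Bool) + ℵ₀ ≤ (#ι + ℵ₀) + (#ι + ℵ₀) := by
        refine add_le_add ?_ (self_le_add_left _ _)
        refine (mul_le_mul' (self_le_add_right _ ℵ₀) (hQ.trans (self_le_add_left _ #ι))).trans_eq ?_
        exact Cardinal.mul_eq_self (self_le_add_left _ _)
    _ = #ι + ℵ₀ := Cardinal.add_eq_self (self_le_add_left _ _)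

theorem mk_continuousMap_le_of_denseRange {D X : Type u} [TopologicalSpace X]
    (hD : #D = Cardinal.continuum.{u}) {i : D → X} (hi : DenseRange i) :
    #C(X, ℝ) ≤ 2 ^ Cardinal.continuum.{u} := by
  have hinj : Function.Injective fun (f : C(X, ℝ)) (d : D) => f (i d) := fun f g hfg =>
    ContinuousMap.coe_injective (hi.equalizer f.continuous g.continuous hfg)
  refine (Cardinal.mk_le_of_injective hinj).trans_eq ?_
  rw [Cardinal.mk_arrow, Cardinal.mk_real, Cardinal.lift_continuum, hD, Cardinal.lift_continuum,
    ← Cardinal.two_power_aleph0, ← Cardinal.power_mul, Cardinal.two_power_aleph0,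
    Cardinal.aleph0_mul_continuum]

theorem IsClopen.isCozeroSet {X : Type*} [TopologicalSpace X] {U : Set X} (hU : IsClopen U) :
    IsCozeroSet U := by
  refine ⟨LocallyConstant.charFn ℝ hU, ?_⟩
  ext x
  by_cases hx : x ∈ U <;> simp [LocallyConstant.coe_charFn, hx]

/-! ### The `cz`-network weight of `D_ω` -/

section CzNetwork

variable {D : Type u} [TopologicalSpace D] [DiscreteTopology D]

/-- Every nonempty `G_δ` subset of `βD` meets `D_ω`. -/
theorem exists_mem_countableClosureUnion_of_forall_mem_isOpen {ι : Type*} [Countable ι]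
    [Nonempty ι] {U : ι → Set (StoneCech D)} (hU : ∀ i, IsOpen (U i)) {x : StoneCech D}
    (hx : ∀ i, x ∈ U i) : ∃ y ∈ countableClosureUnion D, ∀ i, y ∈ U i := by
  obtain ⟨e, he⟩ := exists_surjective_nat ι
  choose A _ hxA hAU using fun n : ℕ =>
    exists_closure_stoneCechUnit_subset (hx (e n)) (hU (e n)) (mem_closure_stoneCechUnit_univ x)
  -- A finite intersection of these clopen neighbourhoods of `x` is open and nonempty, so it meets
  -- `D`. A cluster point of the resulting sequence lies in every `closure (stoneCechUnit '' A i)`,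
  -- which contains a tail.
  have hd : ∀ n : ℕ, ∃ d : D, ∀ i ≤ n, stoneCechUnit d ∈ closure (stoneCechUnit '' A i) := by
    intro n
    obtain ⟨_, hy, d, rfl⟩ := denseRange_stoneCechUnit.inter_open_nonempty
      (⋂ i ∈ Set.Iic n, closure (stoneCechUnit '' A i))
      ((Set.finite_Iic n).isOpen_biInter fun i _ => (isClopen_closure_stoneCechUnit (A i)).2)
      ⟨x, Set.mem_iInter₂.2 fun i _ => hxA i⟩
    exact ⟨d, fun i hi => Set.mem_iInter₂.1 hy i hi⟩
  choose d hd using hd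
  obtain ⟨y, hy, hyc⟩ := (isClosed_closure (s := stoneCechUnit '' Set.range d)).isCompact
    (f := Filter.map (fun n => stoneCechUnit (d n)) Filter.atTop)
    (Filter.le_principal_iff.2 (Filter.eventually_map.2 (Filter.Eventually.of_forall fun n =>
      subset_closure ⟨d n, ⟨n, rfl⟩, rfl⟩)))
  refine ⟨y, closure_stoneCechUnit_subset_countableClosureUnion (Set.countable_range d) hy,
    fun i => ?_⟩
  obtain ⟨n, rfl⟩ := he i
  refine hAU n (isClosed_iff_clusterPt.1 isClosed_closure y (hyc.mono ?_))
  exact Filter.le_principal_iff.2 (Filter.eventually_map.2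
    (Filter.eventually_atTop.2 ⟨n, fun m hm => hd m n hm⟩))

/-- Countably many members make up the trace of `U`. If `x` avoided all their closures, `U` minus
these closures would be a nonempty `G_δ` and would meet `D_ω` in a point of the trace that no member
covers. -/
theorem IsCzNetwork.exists_mem_closure_subset {𝒩 : Set (Set (countableClosureUnion D))}
    (h : IsCzNetwork 𝒩) {U : Set (StoneCech D)} (hU : IsClopen U) {x : StoneCech D}
    (hx : x ∈ U) :
    ∃ N ∈ 𝒩, x ∈ closure (Subtype.val '' N) ∧ closure (Subtype.val '' N) ⊆ U := by
  obtain ⟨ℳ, hℳ, hc, hUℳ⟩ := h _ (hU.preimage continuous_subtype_val).isCozeroSet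
  have hsub : ∀ N ∈ ℳ, closure (Subtype.val '' N) ⊆ U := fun N hN =>
    closure_minimal (Set.image_subset_iff.2 (hUℳ ▸ Set.subset_sUnion_of_mem hN)) hU.1
  by_contra! hcon
  have : Countable ℳ := hc
  obtain ⟨y, hy, hyU⟩ := exists_mem_countableClosureUnion_of_forall_mem_isOpen
    -- The index `none` carries `U` itself, the others the complements of the closures.
    (U := fun o : Option ℳ => o.elim U fun N =>
      (closure (Subtype.val '' (N : Set (countableClosureUnion D))))ᶜ)
    (x := x) (by
      rintro (_ | N)
      · exact hU.2
      · exact isClosed_closure.isOpen_compl) (by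
      rintro (_ | N)
      · exact hx
      · exact fun hxN => hcon N (hℳ N.2) hxN (hsub N N.2))
  obtain ⟨N, hN, hyN⟩ := hUℳ.symm.subset (show (⟨y, hy⟩ : countableClosureUnion D) ∈ _ from
    hyU none)
  exact hyU (some ⟨N, hN⟩) (subset_closure ⟨_, hyN, rfl⟩)

theorem IsCzNetwork.weight_stoneCech_le {𝒩 : Set (Set (countableClosureUnion D))}
    (h : IsCzNetwork 𝒩) : weight (StoneCech D) ≤ #𝒩 + ℵ₀ := by
  -- One clopen set is chosen per pair of members. It may differ from the set that separated two
  -- given points, but it separates them as well, and only `#𝒩 * #𝒩` choices are made.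
  let P := {p : 𝒩 × 𝒩 // ∃ V : Set (StoneCech D), IsClopen V ∧
    closure (Subtype.val '' (p.1 : Set (countableClosureUnion D))) ⊆ V ∧
    closure (Subtype.val '' (p.2 : Set (countableClosureUnion D))) ⊆ Vᶜ}
  choose V hV hV₁ hV₂ using fun p : P => p.2
  have hw : weight (StoneCech D) ≤ #P + ℵ₀ := by
    refine weight_le_of_separating (fun p : P => LocallyConstant.charFn ℝ (hV p))
      (fun p => (LocallyConstant.charFn ℝ (hV p)).continuous) fun x y hxy => ?_
    obtain ⟨B, -, hxB, hBy⟩ := exists_closure_stoneCechUnit_subset (U := {y}ᶜ) hxy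
      isOpen_compl_singleton (mem_closure_stoneCechUnit_univ x)
    have hB := isClopen_closure_stoneCechUnit B
    obtain ⟨N₁, hN₁, hxN, hN₁B⟩ := h.exists_mem_closure_subset hB hxB
    obtain ⟨N₂, hN₂, hyN, hN₂B⟩ := h.exists_mem_closure_subset hB.compl
      (fun hy => hBy hy rfl : y ∈ (closure (stoneCechUnit '' B))ᶜ)
    let p : P := ⟨(⟨N₁, hN₁⟩, ⟨N₂, hN₂⟩), _, hB, hN₁B, hN₂B⟩
    refine ⟨p, ?_⟩
    have h₁ : x ∈ V p := hV₁ p hxN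
    have h₂ : y ∉ V p := hV₂ p hyN
    simp [LocallyConstant.coe_charFn, h₁, h₂]
  refine hw.trans ?_
  have hP : #P ≤ #𝒩 * #𝒩 := (Cardinal.mk_subtype_le _).trans_eq (by simp)
  calc #P + ℵ₀ ≤ (#𝒩 + ℵ₀) + (#𝒩 + ℵ₀) := by
        refine add_le_add (hP.trans ?_) (self_le_add_left _ _)
        refine (mul_le_mul' (self_le_add_right _ ℵ₀) (self_le_add_right _ ℵ₀)).trans_eq ?_
        exact Cardinal.mul_eq_self (self_le_add_left _ _)
    _ = #𝒩 + ℵ₀ := Cardinal.add_eq_self (self_le_add_left _ _)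

theorem isCzNetwork_setOf_isCozeroSet (X : Type*) [TopologicalSpace X] :
    IsCzNetwork {U : Set X | IsCozeroSet U} :=
  fun U hU => ⟨{U}, by simpa using hU, Set.countable_singleton U, by simp⟩

theorem czNetworkWeight_countableClosureUnion (hD : #D = Cardinal.continuum.{u}) :
    czNetworkWeight (countableClosureUnion D) = 2 ^ Cardinal.continuum.{u} := by
  have : Infinite D := Cardinal.infinite_iff.2 (hD ▸ Cardinal.aleph0_le_continuum)
  have hinf : ℵ₀ ≤ 2 ^ Cardinal.continuum.{u} :=
    Cardinal.aleph0_le_continuum.trans (Cardinal.cantor _).le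
  apply le_antisymm
  · refine (add_le_add_left (csInf_le' (s := {κ | ∃ 𝒩 : Set (Set (countableClosureUnion D)),
      IsCzNetwork 𝒩 ∧ #𝒩 = κ}) ⟨_, isCzNetwork_setOf_isCozeroSet _, rfl⟩) _).trans ?_
    have hsub : {U : Set (countableClosureUnion D) | IsCozeroSet U} ⊆
        Set.range (fun f : C(countableClosureUnion D, ℝ) => {x | f x = 0}ᶜ) := by
      rintro _ ⟨f, rfl⟩
      exact ⟨f, rfl⟩
    have hi : DenseRange fun d : D => (⟨stoneCechUnit d,
        range_stoneCechUnit_subset_countableClosureUnion ⟨d, rfl⟩⟩ : countableClosureUnion D) := by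
      intro x
      rw [Topology.IsInducing.subtypeVal.closure_eq_preimage_closure_image, Set.mem_preimage,
        ← Set.range_comp]
      exact denseRange_stoneCechUnit _
    refine (add_le_add_left ((Cardinal.mk_le_mk_of_subset hsub).trans
      (Cardinal.mk_range_le.trans (mk_continuousMap_le_of_denseRange hD hi))) _).trans_eq ?_
    exact Cardinal.add_eq_left hinf hinf
  · obtain ⟨𝒩, h, h'⟩ := csInf_mem (s := {κ | ∃ 𝒩 : Set (Set (countableClosureUnion D)),
      IsCzNetwork 𝒩 ∧ #𝒩 = κ}) ⟨_, _, isCzNetwork_setOf_isCozeroSet _, rfl⟩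
    rw [czNetworkWeight, ← h', ← hD, ← weight_stoneCech]
    exact h.weight_stoneCech_le

end CzNetwork

/-! ### Radon probability measures and their extreme points -/

open MeasureTheory

section RadonProb

variable {X : Type u} [TopologicalSpace X] [CompactSpace X] [MeasurableSpace X] [BorelSpace X]

theorem diracFunctional_apply [T2Space X] (x : X) (f : C(X, ℝ)) : diracFunctional x f = f x :=
  (integralFunctional_apply _ f).trans (integral_dirac _ _)

theorem continuous_integralFunctional :
    Continuous (integralFunctional : ProbabilityMeasure X → WeakDual ℝ C(X, ℝ)) := by
  refine WeakDual.continuous_of_continuous_eval fun f => ?_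
  exact continuous_iff_continuousAt.2 fun μ =>
    (ProbabilityMeasure.tendsto_iff_forall_integral_tendsto.1 (Filter.tendsto_id (x := 𝓝 μ)))
      (BoundedContinuousFunction.mkOfCompact f)

theorem isInducing_integralFunctional :
    Topology.IsInducing (integralFunctional : ProbabilityMeasure X → WeakDual ℝ C(X, ℝ)) := by
  refine Topology.isInducing_iff_nhds.2 fun μ => le_antisymm
    (continuous_integralFunctional.tendsto μ).le_comap ?_
  refine Filter.tendsto_id'.1 (ProbabilityMeasure.tendsto_iff_forall_integral_tendsto.2 fun f => ?_)
  exact ((WeakDual.eval_continuous (f : C(X, ℝ))).tendsto _).comp Filter.tendsto_comap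

variable [T2Space X]

/-- The Radon probability measures are the positive normalised functionals
(Riesz–Markov–Kakutani). -/
theorem mem_radonProbConvex_iff {φ : WeakDual ℝ C(X, ℝ)} :
    φ ∈ radonProbConvex X ↔ (∀ f : C(X, ℝ), 0 ≤ f → 0 ≤ φ f) ∧ φ 1 = 1 := by
  constructor
  · rintro ⟨μ, -, rfl⟩
    refine ⟨fun f hf => ?_, ?_⟩
    · rw [integralFunctional_apply]
      exact integral_nonneg fun x => hf x
    · rw [integralFunctional_apply]
      simp
  · rintro ⟨hpos, hone⟩
    let Λ : CompactlySupportedContinuousMap X ℝ →ₚ[ℝ] ℝ := PositiveLinearMap.mk₀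
      { toFun := fun g => φ g.toContinuousMap
        map_add' := fun g g' => map_add φ g.toContinuousMap g'.toContinuousMap
        map_smul' := fun c g => map_smul φ c g.toContinuousMap }
      fun g hg => hpos _ hg
    have hint : ∀ f : C(X, ℝ), ∫ x, f x ∂(RealRMK.rieszMeasure Λ) = φ f := fun f =>
      RealRMK.integral_rieszMeasure Λ ⟨f, HasCompactSupport.of_compactSpace _⟩
    have hprob : IsProbabilityMeasure (RealRMK.rieszMeasure Λ) := by
      have h := hint 1
      rw [hone] at h
      simp only [ContinuousMap.one_apply, integral_const, smul_eq_mul, mul_one] at h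
      exact ⟨(ENNReal.toReal_eq_one_iff _).1 h⟩
    refine ⟨⟨RealRMK.rieszMeasure Λ, hprob⟩, ?_, ?_⟩
    · change (RealRMK.rieszMeasure Λ).InnerRegular
      infer_instance
    · exact DFunLike.ext _ _ hint

theorem diracFunctional_mem_radonProbConvex (x : X) : diracFunctional x ∈ radonProbConvex X :=
  mem_radonProbConvex_iff.2
    ⟨fun f hf => by rw [diracFunctional_apply]; exact hf x, by rw [diracFunctional_apply]; rfl⟩

theorem convex_radonProbConvex : Convex ℝ (radonProbConvex X) := by
  intro φ hφ ψ hψ a b ha hb hab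
  rw [mem_radonProbConvex_iff] at hφ hψ ⊢
  refine ⟨fun f hf => ?_, ?_⟩
  · exact add_nonneg (mul_nonneg ha (hφ.1 f hf)) (mul_nonneg hb (hψ.1 f hf))
  · change a * φ 1 + b * ψ 1 = 1
    rw [hφ.2, hψ.2, mul_one, mul_one, hab]

/-- Positivity and normalisation are weak-* closed conditions inside the dual unit ball, which is
compact by Banach–Alaoglu. -/
theorem isCompact_radonProbConvex : IsCompact (radonProbConvex X) := by
  refine (WeakDual.isCompact_closedBall (𝕜 := ℝ) (E := C(X, ℝ)) 0 1).of_isClosed_subset ?_ ?_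
  · have : radonProbConvex X =
        (⋂ f : {f : C(X, ℝ) // 0 ≤ f}, {φ : WeakDual ℝ C(X, ℝ) | 0 ≤ φ f.1}) ∩
          {φ : WeakDual ℝ C(X, ℝ) | φ 1 = 1} := by
      ext φ
      simp [mem_radonProbConvex_iff]
    rw [this]
    exact (isClosed_iInter fun f : {f : C(X, ℝ) // 0 ≤ f} =>
      isClosed_le continuous_const (WeakDual.eval_continuous f.1)).inter
      (isClosed_eq (WeakDual.eval_continuous 1) continuous_const)
  · rintro _ ⟨μ, -, rfl⟩
    rw [Set.mem_preimage, mem_closedBall_zero_iff]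
    refine ContinuousLinearMap.opNorm_le_bound _ zero_le_one fun f => ?_
    have h := norm_integral_le_of_norm_le_const (μ := (μ : Measure X)) (f := fun x => f x)
      (Filter.Eventually.of_forall f.norm_coe_le_norm)
    rw [probReal_univ, mul_one] at h
    exact (one_mul ‖f‖).symm ▸ h

/-- Inner regularity serves injectivity: it lets the integrals of continuous functions determine the
measure. -/
theorem isEmbedding_integralFunctional_radonProb :
    Topology.IsEmbedding (fun μ : radonProb X => integralFunctional μ.1) := by
  refine ⟨isInducing_integralFunctional.comp Topology.IsInducing.subtypeVal, ?_⟩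
  rintro ⟨μ, hμ⟩ ⟨ν, hν⟩ h
  have : (μ : Measure X).InnerRegular := hμ
  have : (ν : Measure X).InnerRegular := hν
  have hμν : (μ : Measure X) = ν := Measure.ext_of_integral_eq_on_compactlySupported fun f => ?_
  · exact Subtype.ext (Subtype.ext hμν)
  exact DFunLike.congr_fun h f.toContinuousMap

theorem isEmbedding_diracFunctional :
    Topology.IsEmbedding (diracFunctional : X → WeakDual ℝ C(X, ℝ)) := by
  refine Continuous.isClosedEmbedding ?_ ?_ |>.isEmbedding
  · refine WeakDual.continuous_of_continuous_eval fun f => ?_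
    simpa only [diracFunctional_apply] using f.continuous
  · intro x y h
    refine (WeakDual.CharacterSpace.continuousMapEval_bijective (X := X) (𝕜 := ℝ)).1
      (WeakDual.CharacterSpace.ext fun f => ?_)
    have := DFunLike.congr_fun h f
    rwa [diracFunctional_apply, diracFunctional_apply] at this

theorem diracFunctional_mem_extremePoints (x : X) :
    diracFunctional x ∈ (radonProbConvex X).extremePoints ℝ := by
  refine ⟨diracFunctional_mem_radonProbConvex x, ?_⟩
  have key : ∀ φ ∈ radonProbConvex X, ∀ ψ ∈ radonProbConvex X, ∀ a b : ℝ, 0 < a → 0 < b →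
      a • φ + b • ψ = diracFunctional x → φ = diracFunctional x := by
    intro φ hφ ψ hψ a b ha hb h
    rw [mem_radonProbConvex_iff] at hφ hψ
    refine DFunLike.ext _ _ fun f => ?_
    rw [diracFunctional_apply]
    have hcf : φ (f x • (1 : C(X, ℝ))) = f x := by rw [map_smul, hφ.2, smul_eq_mul, mul_one]
    -- The Dirac functional kills `|f - f x|`. Both summands are nonnegative on it, so `φ` kills it
    -- too, which forces `φ f = f x`.
    have hzero : φ |f - f x • (1 : C(X, ℝ))| ≤ 0 := by
      have h0 := DFunLike.congr_fun h |f - f x • (1 : C(X, ℝ))|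
      have h0 : a * φ |f - f x • (1 : C(X, ℝ))| + b * ψ |f - f x • (1 : C(X, ℝ))| = 0 := by
        refine h0.trans ?_
        rw [diracFunctional_apply]
        simp
      have h1 := mul_nonneg hb.le (hψ.1 _ (abs_nonneg (f - f x • (1 : C(X, ℝ)))))
      exact nonpos_of_mul_nonpos_right (by linarith) ha
    have h1 := hφ.1 _ (sub_nonneg.2 (le_abs_self (f - f x • (1 : C(X, ℝ)))))
    have h2 := hφ.1 _ (sub_nonneg.2 (neg_le_abs (f - f x • (1 : C(X, ℝ)))))
    rw [map_sub, map_sub, hcf] at h1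
    rw [map_sub, map_neg, map_sub, hcf] at h2
    linarith
  rintro φ hφ ψ hψ ⟨a, b, ha, hb, -, h⟩
  exact key φ hφ ψ hψ a b ha hb h

/-- An extreme `φ` is multiplicative, and characters of `C(X, ℝ)` are point evaluations. Indeed, for
`0 ≤ h ≤ 1` the densities `h` and `1 - h` split `φ` into a convex combination, and extremality gives
`φ (h * f) = φ h * φ f`. -/
theorem extremePoints_radonProbConvex :
    (radonProbConvex X).extremePoints ℝ =
      Set.range (diracFunctional : X → WeakDual ℝ C(X, ℝ)) := by
  refine Set.Subset.antisymm (fun φ hφ => ?_)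
    (Set.range_subset_iff.2 diracFunctional_mem_extremePoints)
  have hφK := mem_radonProbConvex_iff.1 hφ.1
  -- the functional `f ↦ φ (h * f) / φ h`
  let Ψ : C(X, ℝ) → WeakDual ℝ C(X, ℝ) := fun h => StrongDual.toWeakDual
    ((φ h)⁻¹ • (WeakDual.toStrongDual φ).comp (ContinuousLinearMap.mul ℝ C(X, ℝ) h))
  have hΨ : ∀ h f, Ψ h f = (φ h)⁻¹ * φ (h * f) := fun h f => rfl
  have hΨK : ∀ h, 0 ≤ h → 0 < φ h → Ψ h ∈ radonProbConvex X := by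
    intro h hh hpos
    refine mem_radonProbConvex_iff.2 ⟨fun f hf => ?_, ?_⟩
    · rw [hΨ]
      exact mul_nonneg (inv_nonneg.2 hpos.le) (hφK.1 _ (mul_nonneg hh hf))
    · rw [hΨ, mul_one, inv_mul_cancel₀ hpos.ne']
  have hmul₀ : ∀ h : C(X, ℝ), 0 ≤ h → h ≤ 1 → 0 < φ h → φ h < 1 → ∀ f, φ (h * f) = φ h * φ f := by
    intro h h0 h1 hpos hlt f
    have hsub : φ (1 - h) = 1 - φ h := by rw [map_sub, hφK.2]
    have hpos' : 0 < φ (1 - h) := by rw [hsub]; linarith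
    have heq : Ψ h = φ := by
      refine hφ.2 (hΨK h h0 hpos) (hΨK (1 - h) (sub_nonneg.2 h1) hpos')
        ⟨φ h, φ (1 - h), hpos, hpos', by rw [hsub]; ring, DFunLike.ext _ _ fun g => ?_⟩
      change φ h * ((φ h)⁻¹ * φ (h * g)) + φ (1 - h) * ((φ (1 - h))⁻¹ * φ ((1 - h) * g)) = φ g
      rw [mul_inv_cancel_left₀ hpos.ne', mul_inv_cancel_left₀ hpos'.ne', ← map_add]
      congr 1
      ring
    have := DFunLike.congr_fun heq f
    rw [hΨ] at this
    rw [← this, mul_inv_cancel_left₀ hpos.ne']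
  have hmul : ∀ h f : C(X, ℝ), φ (h * f) = φ h * φ f := by
    intro h f
    -- Scaled by `c` and shifted by `1/2`, any `h` takes values in `[1/4, 3/4]`, so `φ k` avoids the
    -- degenerate values `0` and `1`. Linearity carries the product rule back to `h`.
    set c : ℝ := (4 * (‖h‖ + 1))⁻¹ with hc
    have hcpos : 0 < c := by positivity
    let k : C(X, ℝ) := c • h + (1 / 2 : ℝ) • 1
    have hch : ∀ x, |c * h x| ≤ 1 / 4 := by
      intro x
      rw [abs_mul, abs_of_pos hcpos, hc, inv_mul_le_iff₀ (by positivity)]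
      have := h.norm_coe_le_norm x
      rw [Real.norm_eq_abs] at this
      linarith
    have hk : ∀ x, 1 / 4 ≤ k x ∧ k x ≤ 3 / 4 := by
      intro x
      have h1 := abs_le.1 (hch x)
      have h2 : k x = c * h x + 1 / 2 := by simp [k]
      rw [h2]
      constructor <;> linarith
    have hlow : (1 / 4 : ℝ) ≤ φ k := by
      have := hφK.1 (k - (1 / 4 : ℝ) • 1) fun x => by
        have := (hk x).1
        simpa using this
      rw [map_sub, map_smul, hφK.2, smul_eq_mul] at this
      linarith
    have hup : φ k ≤ (3 / 4 : ℝ) := by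
      have := hφK.1 ((3 / 4 : ℝ) • 1 - k) fun x => by
        have := (hk x).2
        simpa using this
      rw [map_sub, map_smul, hφK.2, smul_eq_mul] at this
      linarith
    have hkm := hmul₀ k (fun x => le_trans (by norm_num) (hk x).1)
      (fun x => (hk x).2.trans (by norm_num)) (by linarith) (by linarith) f
    simp only [k, add_mul, smul_mul_assoc, one_mul, map_add, map_smul, smul_eq_mul, hφK.2] at hkm
    have : c * φ (h * f) = c * (φ h * φ f) := by linarith
    exact mul_left_cancel₀ hcpos.ne' this
  have hchar : φ ∈ WeakDual.characterSpace ℝ C(X, ℝ) := by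
    rw [WeakDual.CharacterSpace.eq_set_map_one_map_mul]
    exact ⟨hφK.2, hmul⟩
  obtain ⟨x, hx⟩ := (WeakDual.CharacterSpace.continuousMapEval_bijective
    (X := X) (𝕜 := ℝ)).2 ⟨φ, hchar⟩
  refine ⟨x, DFunLike.ext _ _ fun f => ?_⟩
  rw [diracFunctional_apply]
  exact DFunLike.congr_fun (congrArg Subtype.val hx) f

instance locallyConvexSpace_weakDual_continuousMap : LocallyConvexSpace ℝ (WeakDual ℝ C(X, ℝ)) :=
  inferInstanceAs (LocallyConvexSpace ℝ (WeakBilin (topDualPairing ℝ C(X, ℝ))))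

end RadonProb

/-! ### Maxima of affine functions, the boundary and the weight of `K` -/

/-- Bauer's maximum principle: a continuous affine function on a compact set `K` attains its
maximum at an extreme point. -/
theorem IsCompact.exists_mem_extremePoints_forall_le {E : Type*} [AddCommGroup E] [Module ℝ E]
    [TopologicalSpace E] [IsTopologicalAddGroup E] [ContinuousSMul ℝ E] [LocallyConvexSpace ℝ E]
    [T2Space E] {K : Set E} (hK : IsCompact K) (hne : K.Nonempty) {f : E → ℝ}
    (hf : ContinuousOn f K)
    (haff : ∀ x ∈ K, ∀ y ∈ K, ∀ a b : ℝ, 0 ≤ a → 0 ≤ b → a + b = 1 →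
      f (a • x + b • y) = a * f x + b * f y) :
    ∃ b ∈ K.extremePoints ℝ, ∀ x ∈ K, f x ≤ f b := by
  obtain ⟨z, hz, hzmax⟩ := hK.exists_isMaxOn hne hf
  have hclosed : IsClosed (K ∩ f ⁻¹' {f z}) :=
    hf.preimage_isClosed_of_isClosed hK.isClosed isClosed_singleton
  have hext : IsExtreme ℝ K (K ∩ f ⁻¹' {f z}) := by
    refine ⟨Set.inter_subset_left, fun x hx y hy w hw hwxy => ⟨hx, ?_⟩⟩
    obtain ⟨a, b, ha, hb, hab, rfl⟩ := hwxy
    have h := hw.2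
    rw [Set.mem_preimage, Set.mem_singleton_iff, haff x hx y hy a b ha.le hb.le hab] at h
    have hfx : f x ≤ f z := hzmax hx
    have hfy : f y ≤ f z := hzmax hy
    rw [Set.mem_preimage, Set.mem_singleton_iff]
    refine hfx.antisymm (not_lt.1 fun hlt => ?_)
    have h1 := mul_lt_mul_of_pos_left hlt ha
    have h2 := mul_le_mul_of_nonneg_left hfy hb.le
    have h3 : a * f z + b * f z = f z := by rw [← add_mul, hab, one_mul]
    linarith
  -- By Krein–Milman the compact face where `f` is maximal has an extreme point, which is extreme in
  -- `K`.
  obtain ⟨b, hb⟩ := (hK.of_isClosed_subset hclosed Set.inter_subset_left).extremePoints_nonempty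
    ⟨z, hz, rfl⟩
  refine ⟨b, hext.extremePoints_subset_extremePoints hb, fun x hx => ?_⟩
  rw [show f b = f z from hb.1.2]
  exact hzmax hx

section StoneCechRadonProb

variable {D : Type u} [TopologicalSpace D] [MeasurableSpace (StoneCech D)]
  [BorelSpace (StoneCech D)]

theorem isConvexBoundary_diracFunctional_countableClosureUnion [Nonempty D] :
    IsConvexBoundary (radonProbConvex (StoneCech D))
      (diracFunctional '' countableClosureUnion D) := by
  refine ⟨Set.image_subset_iff.2 fun x _ => diracFunctional_mem_radonProbConvex x,
    fun f hf haff => ?_⟩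
  obtain ⟨φ, hφ, hφmax⟩ := isCompact_radonProbConvex.exists_mem_extremePoints_forall_le
    ⟨_, diracFunctional_mem_radonProbConvex (stoneCechUnit (Classical.arbitrary D))⟩ hf haff
  rw [extremePoints_radonProbConvex] at hφ
  obtain ⟨x, rfl⟩ := hφ
  obtain ⟨b, hb, hbmax⟩ := exists_mem_countableClosureUnion_forall_le
    (hf.comp_continuous isEmbedding_diracFunctional.continuous diracFunctional_mem_radonProbConvex)
  exact ⟨_, ⟨b, hb, rfl⟩, fun ψ hψ => (hφmax ψ hψ).trans (hbmax x)⟩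

/-- Evaluations at the at most `2^𝔠` continuous functions separate the points of `K`; conversely
`βD` embeds in `K` through Dirac measures. -/
theorem weight_radonProbConvex_stoneCech [DiscreteTopology D] (hD : #D = Cardinal.continuum.{u}) :
    weight (radonProbConvex (StoneCech D)) = 2 ^ Cardinal.continuum.{u} := by
  have : Infinite D := Cardinal.infinite_iff.2 (hD ▸ Cardinal.aleph0_le_continuum)
  have hinf : ℵ₀ ≤ 2 ^ Cardinal.continuum.{u} :=
    Cardinal.aleph0_le_continuum.trans (Cardinal.cantor _).le
  apply le_antisymm
  · have : CompactSpace (radonProbConvex (StoneCech D)) :=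
      isCompact_iff_compactSpace.1 isCompact_radonProbConvex
    refine (weight_le_of_separating (ι := C(StoneCech D, ℝ))
      (fun (f : C(StoneCech D, ℝ)) (φ : radonProbConvex (StoneCech D)) => φ.1 f)
      (fun f => (WeakDual.eval_continuous f).comp continuous_subtype_val) fun φ ψ h => ?_).trans ?_
    · by_contra! hcon
      exact h (Subtype.ext (DFunLike.ext _ _ hcon))
    · exact (add_le_add_left (mk_continuousMap_le_of_denseRange hD denseRange_stoneCechUnit)
        _).trans_eq (Cardinal.add_eq_left hinf hinf)
  · rw [← hD, ← weight_stoneCech]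
    exact (isEmbedding_diracFunctional.codRestrict (radonProbConvex (StoneCech D))
      diracFunctional_mem_radonProbConvex).weight_le

end StoneCechRadonProb

/-! ### The main theorem -/

theorem mainTheorem8 {D : Type u} [TopologicalSpace D] [DiscreteTopology D]
    (hD : #D = Cardinal.continuum.{u})
    [MeasurableSpace (StoneCech D)] [BorelSpace (StoneCech D)] :
    -- the space `D_ω`
    (Set.range (stoneCechUnit : D → StoneCech D) ⊆ countableClosureUnion D ∧
      Dense (countableClosureUnion D) ∧
      LocallyCompactSpace (countableClosureUnion D) ∧
      CountablyCompactSpace (countableClosureUnion D) ∧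
      IsHomeomorph (stoneCechExtend
        (continuous_subtype_val :
          Continuous (Subtype.val : countableClosureUnion D → StoneCech D))) ∧
      (∃ 𝒞 : Set (Set (StoneCech D)), #𝒞 = Cardinal.continuum.{u} ∧
        ⋃₀ 𝒞 = countableClosureUnion D ∧
        ∀ C ∈ 𝒞, IsCompact C ∧ weight C = Cardinal.continuum.{u}) ∧
      weight (countableClosureUnion D) = Cardinal.continuum.{u}) ∧
    -- the convex compact set `K = P(βD)`
    (Convex ℝ (radonProbConvex (StoneCech D)) ∧
      IsCompact (radonProbConvex (StoneCech D)) ∧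
      Topology.IsEmbedding (fun μ : radonProb (StoneCech D) => integralFunctional μ.1) ∧
      Topology.IsEmbedding (diracFunctional : StoneCech D → WeakDual ℝ C(StoneCech D, ℝ)) ∧
      (radonProbConvex (StoneCech D)).extremePoints ℝ =
        Set.range (diracFunctional : StoneCech D → WeakDual ℝ C(StoneCech D, ℝ)) ∧
      weight (StoneCech D) = 2 ^ Cardinal.continuum.{u} ∧
      weight (radonProbConvex (StoneCech D)) = 2 ^ Cardinal.continuum.{u}) ∧
    -- `D_ω` is a boundary of `K` of smaller weight
    IsConvexBoundary (radonProbConvex (StoneCech D))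
      (diracFunctional '' countableClosureUnion D) ∧
    weight (countableClosureUnion D) < weight (radonProbConvex (StoneCech D)) ∧
    -- hence the weight of a boundary need not be the weight of the convex compact set
    (¬ ∀ (E : Type u) [AddCommGroup E] [Module ℝ E] [TopologicalSpace E]
        [IsTopologicalAddGroup E] [ContinuousSMul ℝ E] [LocallyConvexSpace ℝ E] [T2Space E]
        (K B : Set E), Convex ℝ K → IsCompact K → IsConvexBoundary K B →
        weight B = weight K) ∧
    -- the `cz`-network weight and the network weight of `D_ω`
    czNetworkWeight (countableClosureUnion D) = 2 ^ Cardinal.continuum.{u} ∧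
    networkWeight (countableClosureUnion D) = Cardinal.continuum.{u} ∧
    networkWeight (countableClosureUnion D) < czNetworkWeight (countableClosureUnion D) := by
  have : Infinite D := Cardinal.infinite_iff.2 (hD ▸ Cardinal.aleph0_le_continuum)
  have hw : weight (countableClosureUnion D) = Cardinal.continuum.{u} :=
    weight_countableClosureUnion hD
  have hK : weight (radonProbConvex (StoneCech D)) = 2 ^ Cardinal.continuum.{u} :=
    weight_radonProbConvex_stoneCech hD
  have hlt : weight (countableClosureUnion D) < weight (radonProbConvex (StoneCech D)) := by
    rw [hw, hK]
    exact Cardinal.cantor _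
  have hbd := isConvexBoundary_diracFunctional_countableClosureUnion (D := D)
  have hcz := czNetworkWeight_countableClosureUnion hD
  have hnw := networkWeight_countableClosureUnion hD
  refine ⟨⟨range_stoneCechUnit_subset_countableClosureUnion, dense_countableClosureUnion,
    isOpen_countableClosureUnion.locallyCompactSpace, inferInstance,
    isHomeomorph_stoneCechExtend_countableClosureUnion,
    exists_compact_cover_countableClosureUnion hD, hw⟩,
    ⟨convex_radonProbConvex, isCompact_radonProbConvex, isEmbedding_integralFunctional_radonProb,
      isEmbedding_diracFunctional, extremePoints_radonProbConvex, hD ▸ weight_stoneCech, hK⟩,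
    hbd, hlt, fun hall => ?_, hcz, hnw, ?_⟩
  · refine hlt.ne ?_
    rw [← hall (WeakDual ℝ C(StoneCech D, ℝ)) _ _ convex_radonProbConvex isCompact_radonProbConvex
      hbd]
    -- As a set of Dirac measures `D_ω` keeps its topology, hence its weight.
    exact (isEmbedding_diracFunctional.homeomorphImage (countableClosureUnion D)).weight_eq
  · rw [hcz, hnw]
    exact Cardinal.cantor _
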